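/- Let $\mathbb k$ be a field of characteristic zero and let $H=S(V)$ be a conilpotent right-handed polynomial Hopf algebra over $\mathbb k$: as an algebra $H$ is the polynomial algebra $S(V)$ over a vector space $V$, its counit is the projection onto $S^0(V)=\mathbb k$, the reduced coproduct $\overline\Delta(x)=\Delta(x)-x\otimes 1-1\otimes x$ satisfies $\overline\Delta(V)\subset V\otimes S(V)$, and every element of the augmentation ideal is annihilated by some iterated reduced coproduct $\overline\Delta^{[n]}$, $n\ge 1$. Here $\overline\Delta^{[1]}=\mathrm{id}$ and, for $k\ge 2$, $$\overline\Delta^{[k]}:=(\mathrm{id}^{\otimes (k-2)}\otimes\overline\Delta)\circ\cdots\circ(\mathrm{id}\otimes\overline\Delta)\circ\overline\Delta : H\to H^{\otimes k}.$$ Let $(b_i)_{i\in X}$ be a basis of $V$, put $b_I=\prod_{i\in I}b_i$ for a finite multiset $I$ over $X$, and let $\lambda^{i;i_0}_I$ be the coefficients in $$\overline\Delta(b_i)=\sum_{i_0\in X,\ I\neq\emptyset}\lambda^{i;i_0}_I\, b_{i_0}\otimes b_I .$$ Trees. The families $\mathcal T_i$ ($i\in X$) of decorated rooted trees are defined recursively: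 $\mathcal T_i$ consists of the one-vertex tree $\bullet_i$, whose vertex is decorated by $i$, and of the trees $T=B^+_{(i;i_0)}(T_1\cdots T_s)$ obtained by adding a root decorated by $(i;i_0)$ to a forest $T_1\cdots T_s$, where $i_0\in X$, $I=\{i_1,\dots,i_s\}$ is a nonempty finite multiset over $X$, and the forest is a family $(T_j)_{1\le j\le s}$, $T_j\in\mathcal T_{i_j}$, indexed by the elements of the multiset $I$. The branches carry no order, but different occurrences of a repeated index in $I$ are distinguished: if $i_j=i_l$ and $T_j\ne T_l$, exchanging $T_j$ and $T_l$ gives a different element of $\mathcal T_i$. For a vertex $x$ of $T$ let $d_2(x)=i_0$ if $x$ is an internal vertex decorated by $(i;i_0)$, and $d_2(x)=i$ if $x$ is a leaf decorated by $i$. Put $\lambda(\bullet_i)=1$ and $\lambda(B^+_{(i;i_0)}(T_1\cdots T_s))=\lambda^{i;i_0}_{\{i_1,\dots,i_s\}}\lambda(T_1)\cdots\lambda(T_s)$. A tree is regarded as the poset of its vertices, with the root as minimum. Linearizations and chains. For $T\in\mathcal T_i$ let $k\text{-lin}(T)$ be the set of surjective maps $f:T\to\{1,\dots,k\}$ such that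 $x<y$ implies $f(x)<f(y)$, and for $f\in k\text{-lin}(T)$ let $$C(f):=\Big(\prod_{x\in f^{-1}(1)}b_{d_2(x)}\Big)\otimes\cdots\otimes\Big(\prod_{x\in f^{-1}(k)}b_{d_2(x)}\Big)\in H^{\otimes k}.$$ Statement. For every $k\ge 2$ and every $i\in X$, only finitely many $T\in\mathcal T_i$ satisfy both $\lambda(T)\ne 0$ and $k\text{-lin}(T)\neq\emptyset$, and $$\overline\Delta^{[k]}(b_i)=\sum_{T\in\mathcal T_i}\ \sum_{f\in k\text{-lin}(T)}\lambda(T)\,C(f).$$ -/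

import Mathlib

open scoped TensorProduct
open PiTensorProduct

noncomputable section

namespace RightHanded

/-! ### Reduced coproduct and its iterations -/

section Coproduct

variable (𝕜 : Type*) (H : Type*) [Field 𝕜] [CommRing H] [HopfAlgebra 𝕜 H]

/-- The reduced coproduct `x ↦ Δ x - x ⊗ 1 - 1 ⊗ x`. -/
def reducedComul : H →ₗ[𝕜] H ⊗[𝕜] H :=
  Coalgebra.comul - (TensorProduct.mk 𝕜 H H).flip 1 - TensorProduct.mk 𝕜 H H 1

/-- The identification of `H` with the tensor power `H^{⊗1}`. -/
def toPowerOne : H ≃ₗ[𝕜] ⨂[𝕜]^1 H :=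
  (PiTensorProduct.subsingletonEquiv (R := 𝕜) (s := fun _ : Fin 1 => H) 0).symm

/-- The identification of `H ⊗ H` with the tensor power `H^{⊗2}`. -/
def toPowerTwo : H ⊗[𝕜] H ≃ₗ[𝕜] ⨂[𝕜]^2 H :=
  (TensorProduct.congr (toPowerOne 𝕜 H) (toPowerOne 𝕜 H)).trans
    (TensorPower.mulEquiv (R := 𝕜) (M := H) (n := 1) (m := 1))

variable {H} in
/-- The map `id^{⊗ n} ⊗ g : H^{⊗ (n+1)} → H^{⊗ (n+2)}` applying `g : H → H ⊗ H` to the last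
tensor factor. -/
def applyLast (g : H →ₗ[𝕜] H ⊗[𝕜] H) (n : ℕ) : ⨂[𝕜]^(n + 1) H →ₗ[𝕜] ⨂[𝕜]^(n + 2) H :=
  (TensorPower.mulEquiv (R := 𝕜) (M := H) (n := n) (m := 2)).toLinearMap ∘ₗ
    ((toPowerTwo 𝕜 H).toLinearMap ∘ₗ g ∘ₗ (toPowerOne 𝕜 H).symm.toLinearMap).lTensor (⨂[𝕜]^n H) ∘ₗ
    (TensorPower.mulEquiv (R := 𝕜) (M := H) (n := n) (m := 1)).symm.toLinearMap

/-- The `k`-fold iterated reduced coproduct, with values in `H^{⊗ k}`: it is the identity for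
`k = 1`, the reduced coproduct for `k = 2`, and in general
`(id^{⊗ (k-2)} ⊗ Δ̄) ∘ ... ∘ (id ⊗ Δ̄) ∘ Δ̄`.  (For `k = 0` it is set to `0` and never used.) -/
def iteratedReducedComul : (k : ℕ) → H →ₗ[𝕜] ⨂[𝕜]^k H
  | 0 => 0
  | 1 => (toPowerOne 𝕜 H).toLinearMap
  | n + 2 => applyLast 𝕜 (reducedComul 𝕜 H) n ∘ₗ iteratedReducedComul (n + 1)

end Coproduct

/-- The Hopf algebra `H` is a conilpotent right-handed polynomial Hopf algebra over the vector
space `V` (included in `H` by `incl`): as an algebra `H` is the polynomial (symmetric) algebra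
`S(V)`, its counit is the projection on `S⁰(V)`, the reduced coproduct maps `V` into `V ⊗ H`, and
every element of the augmentation ideal is killed by some iterated reduced coproduct. -/
structure IsRightHandedPolynomial {𝕜 V H : Type*} [Field 𝕜] [AddCommGroup V] [Module 𝕜 V]
    [CommRing H] [HopfAlgebra 𝕜 H] (incl : V →ₗ[𝕜] H) : Prop where
  isSymmetricAlgebra : IsSymmetricAlgebra incl
  counit_incl : ∀ v : V, Coalgebra.counit (R := 𝕜) (incl v) = 0
  rightHanded : ∀ v : V, reducedComul 𝕜 H (incl v) ∈ LinearMap.range (incl.rTensor H)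
  conilpotent : ∀ c : H, Coalgebra.counit (R := 𝕜) c = 0 →
    ∃ n : ℕ, 1 ≤ n ∧ iteratedReducedComul 𝕜 H n c = 0

/-! ### Monomials and structure coefficients -/

section Coefficients

variable {𝕜 V H X : Type*} [Field 𝕜] [AddCommGroup V] [Module 𝕜 V]
  [CommRing H] [HopfAlgebra 𝕜 H] [DecidableEq X] {incl : V →ₗ[𝕜] H}

/-- The basis of `H = S(V)` consisting of the monomials `b_I = ∏_{i ∈ I} b_i`, indexed by the
finite multisets `I` over `X`, where `b` is a basis of `V` indexed by `X`. -/
def monomialBasis (h : IsRightHandedPolynomial incl) (b : Module.Basis X 𝕜 V) :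
    Module.Basis (Multiset X) 𝕜 H :=
  (b.symmetricAlgebra.map h.isSymmetricAlgebra.equiv.toLinearEquiv).reindex
    Multiset.toFinsupp.toEquiv.symm

theorem monomialBasis_apply (h : IsRightHandedPolynomial incl) (b : Module.Basis X 𝕜 V)
    (I : Multiset X) :
    monomialBasis h b I = (I.map fun i => incl (b i)).prod := by
  induction I using Multiset.induction_on with
  | empty => simp [monomialBasis, Module.Basis.symmetricAlgebra]
  | cons a s ih =>
    rw [Multiset.map_cons, Multiset.prod_cons, ← ih]
    have hm : (MvPolynomial.monomial (R := 𝕜) (Finsupp.single a 1 + Multiset.toFinsupp s) 1)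
        = MvPolynomial.X a * MvPolynomial.monomial (Multiset.toFinsupp s) 1 := by
      rw [MvPolynomial.X, MvPolynomial.monomial_mul, one_mul]
    simp [monomialBasis, Module.Basis.symmetricAlgebra, ← Multiset.singleton_add, hm]

/-- The coefficient `λ^{i;i₀}_I` of `b_{i₀} ⊗ b_I` in the reduced coproduct of `b_i`. -/
def structureCoeff (h : IsRightHandedPolynomial incl) (b : Module.Basis X 𝕜 V)
    (i i₀ : X) (I : Multiset X) : 𝕜 :=
  ((monomialBasis h b).tensorProduct (monomialBasis h b)).repr
    (reducedComul 𝕜 H (incl (b i))) ({i₀}, I)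

end Coefficients

/-! ### Decorated trees -/

universe u

/-- `DecTree X i` is the family `𝒯_i` of decorated rooted trees associated to the index `i`.
Such a tree is either a single vertex decorated by `i`, or it is `B⁺_{(i;i₀)}(T_1 ⋯ T_s)`, obtained
by adding a root decorated by `(i;i₀)` to a nonempty forest `T_1 ⋯ T_s`, `T_j ∈ 𝒯_{i_j}`, with
`I = {i_1, ..., i_s}` a multiset. The forest is a family of trees indexed by the elements of the
multiset `I`: the branches carry no order, and the occurrences of a repeated index in `I`
are distinguished. -/
inductive DecTree (X : Type u) [DecidableEq X] : X → Type u
  | leaf (i : X) : DecTree X i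
  | node (i i₀ : X) (I : Multiset X) (hI : I ≠ 0) (branch : (a : I) → DecTree X a.1) : DecTree X i

namespace DecTree

variable {X : Type u} [DecidableEq X]

/-- The set of vertices of a tree. For `B⁺_{(i;i₀)}(T_1 ⋯ T_s)` it is the disjoint union of the sets
of vertices of the `T_j`, with one element `⊥` (the root) added. -/
def Vertex : {i : X} → DecTree X i → Type u
  | _, leaf _ => PUnit
  | _, node _ _ I _ branch => WithBot (Σ a : I, Vertex (branch a))

/-- The tree as a poset: the root is the minimum, and vertices belonging to different branches are
not comparable. -/
instance instPartialOrderVertex : {i : X} → (T : DecTree X i) → PartialOrder T.Vertex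
  | _, leaf _ => inferInstanceAs (PartialOrder PUnit)
  | _, node _ _ I _ branch =>
    letI : ∀ a : I, PartialOrder (branch a).Vertex := fun a => instPartialOrderVertex (branch a)
    inferInstanceAs (PartialOrder (WithBot (Σ a : I, (branch a).Vertex)))

instance instFintypeVertex : {i : X} → (T : DecTree X i) → Fintype T.Vertex
  | _, leaf _ => inferInstanceAs (Fintype PUnit)
  | _, node _ _ I _ branch =>
    letI : ∀ a : I, Fintype (branch a).Vertex := fun a => instFintypeVertex (branch a)
    inferInstanceAs (Fintype (Option (Σ a : I, (branch a).Vertex)))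

/-- The second component `d₂` of the decoration of a vertex: `i₀` for an internal vertex decorated
by `(i;i₀)`, and `i` for a leaf decorated by `i`. -/
def d₂ : {i : X} → (T : DecTree X i) → T.Vertex → X
  | _, leaf i => fun _ => i
  | _, node _ i₀ I _ branch => fun x =>
    WithBot.recBotCoe (C := fun _ => X) i₀ (fun y : Σ a : I, (branch a).Vertex =>
      d₂ (branch y.1) y.2) x

/-- The coefficient `λ(T)`: `λ(•_i) = 1` and
`λ(B⁺_{(i;i₀)}(T_1 ⋯ T_s)) = λ^{i;i₀}_{i_1,...,i_s} λ(T_1) ⋯ λ(T_s)` for `T_j ∈ 𝒯_{i_j}`. -/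
def coeff {𝕜 V H : Type*} [Field 𝕜] [AddCommGroup V] [Module 𝕜 V]
    [CommRing H] [HopfAlgebra 𝕜 H] {incl : V →ₗ[𝕜] H}
    (h : IsRightHandedPolynomial incl) (b : Module.Basis X 𝕜 V) : {i : X} → DecTree X i → 𝕜
  | _, leaf _ => 1
  | _, node i i₀ I _ branch => structureCoeff h b i i₀ I * ∏ a : I, coeff h b (branch a)

end DecTree

/-! ### Linearizations and chains -/

/-- The `k`-linearizations of a poset `P`: the surjective, strictly order preserving maps from `P`
to a chain with `k` elements. -/
def Linearization (P : Type*) [PartialOrder P] (k : ℕ) : Type _ :=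
  {f : P → Fin k // StrictMono f ∧ Function.Surjective f}

open scoped Classical in
instance (P : Type*) [PartialOrder P] [Fintype P] (k : ℕ) : Fintype (Linearization P k) :=
  inferInstanceAs (Fintype {f : P → Fin k // StrictMono f ∧ Function.Surjective f})

/-- The `k`-chain
`C(f) = (∏_{x ∈ f⁻¹(1)} b_{d₂(x)}) ⊗ ⋯ ⊗ (∏_{x ∈ f⁻¹(k)} b_{d₂(x)})` of a `k`-linearization `f`
of a decorated tree. -/
def chain {𝕜 V H X : Type*} [Field 𝕜] [AddCommGroup V] [Module 𝕜 V]
    [CommRing H] [HopfAlgebra 𝕜 H] [DecidableEq X] (incl : V →ₗ[𝕜] H) (b : Module.Basis X 𝕜 V)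
    {i : X} (T : DecTree X i) {k : ℕ} (f : Linearization T.Vertex k) : ⨂[𝕜]^k H :=
  tprod 𝕜 fun j : Fin k => ∏ x : T.Vertex with f.1 x = j, incl (b (T.d₂ x))

end RightHanded

end

/-! The reduced coproduct is not multiplicative, so the expansion is first proved for the full
iterated coproduct Δ^(k) (`iteratedComul`), a morphism of algebras. On the tree side this means
dropping surjectivity: Δ^(k)(b_i) is the sum of λ(T) C(f) over all strictly increasing f : T → {1,
..., k} (`iteratedComul_basis`). The induction on k uses Δ^(k+1) = (id ⊗ Δ^(k)) ∘ Δ. Either f sends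
the root to level 1 and the branches map independently to the other levels, or the whole tree avoids
level 1 (`levelSum_withBot`). The first case matches the terms b_{i₀} ⊗ b_I and b_i ⊗ 1 of Δ(b_i),
the second 1 ⊗ b_i; independence of branches matches multiplicativity of Δ^(k) on b_I
(`levelSum_sigma`).

Projecting every tensor factor to the augmentation ideal turns Δ^(k) into the reduced iterate
(`iteratedReducedComul_augProj`). An empty level carries the factor 1, which is killed, while a
nonempty level is fixed; hence exactly the surjective maps survive.

Finiteness holds because a strict map to k levels bounds the height, and each b_i has finitely many
nonzero λ^{i;i₀}_I (`mem_boundedTrees`). -/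

open scoped TensorProduct
open PiTensorProduct

noncomputable section
namespace RightHanded

/-! ### Tensor powers: adding a factor on the left -/

section TensorCons

variable (𝕜 : Type*) {H : Type*} [Field 𝕜] [CommRing H] [Algebra 𝕜 H]

/-- The bilinear map `(x, t) ↦ x ⊗ t` from `H × H^{⊗ k}` to `H^{⊗ (k+1)}`. -/
def tensorCons (k : ℕ) : H →ₗ[𝕜] ⨂[𝕜]^k H →ₗ[𝕜] ⨂[𝕜]^(k + 1) H :=
  PiTensorProduct.lift.toLinearMap ∘ₗ
    (tprod 𝕜 : MultilinearMap 𝕜 (fun _ : Fin (k + 1) => H) (⨂[𝕜]^(k + 1) H)).curryLeft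

@[simp]
theorem tensorCons_tprod {k : ℕ} (x : H) (f : Fin k → H) :
    tensorCons 𝕜 k x (tprod 𝕜 f) = tprod 𝕜 (Fin.cons x f : Fin (k + 1) → H) := by
  simp [tensorCons]

theorem tensorCons_one_one (k : ℕ) : tensorCons 𝕜 k (1 : H) 1 = 1 := by
  change tensorCons 𝕜 k (1 : H) (PiTensorProduct.tprod 𝕜 1) = PiTensorProduct.tprod 𝕜 1
  rw [tensorCons_tprod]
  congr 1
  ext j
  refine Fin.cases ?_ (fun j => ?_) j <;> simp

theorem tensorCons_mul {k : ℕ} (x y : H) (s t : ⨂[𝕜]^k H) :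
    tensorCons 𝕜 k (x * y) (s * t) = tensorCons 𝕜 k x s * tensorCons 𝕜 k y t := by
  induction s using PiTensorProduct.induction_on with
  | smul_tprod r f =>
    induction t using PiTensorProduct.induction_on with
    | smul_tprod r' g =>
      simp only [smul_mul_smul_comm, map_smul, tensorCons_tprod, tprod_mul_tprod]
      congr 2
      ext j
      refine Fin.cases ?_ (fun j => ?_) j <;> simp
    | add t t' ht ht' => simp only [mul_add, map_add, ht, ht']
  | add s s' hs hs' => simp only [add_mul, map_add, hs, hs']

variable (H) in
/-- The map `x ⊗ t ↦ x ⊗ t` from `H ⊗ H^{⊗ k}` to `H^{⊗ (k+1)}`, as a morphism of algebras. -/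
def consAlgHom (k : ℕ) : H ⊗[𝕜] (⨂[𝕜]^k H) →ₐ[𝕜] ⨂[𝕜]^(k + 1) H :=
  Algebra.TensorProduct.algHomOfLinearMapTensorProduct (TensorProduct.lift (tensorCons 𝕜 k))
    (fun x y s t => by simp [tensorCons_mul])
    (by simp [tensorCons_one_one])

@[simp]
theorem consAlgHom_tmul {k : ℕ} (x : H) (t : ⨂[𝕜]^k H) :
    consAlgHom 𝕜 H k (x ⊗ₜ t) = tensorCons 𝕜 k x t := by
  rfl

theorem map_tensorCons {k : ℕ} (g : H →ₗ[𝕜] H) (x : H) (t : ⨂[𝕜]^k H) :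
    PiTensorProduct.map (fun _ : Fin (k + 1) => g) (tensorCons 𝕜 k x t) =
      tensorCons 𝕜 k (g x) (PiTensorProduct.map (fun _ : Fin k => g) t) := by
  induction t using PiTensorProduct.induction_on with
  | smul_tprod r f =>
    simp only [map_smul, tensorCons_tprod, PiTensorProduct.map_tprod]
    congr 2
    ext j
    refine Fin.cases ?_ (fun j => ?_) j <;> simp
  | add s t hs ht => simp only [map_add, hs, ht]

theorem mulEquiv_tprod_tmul_tprod {n m : ℕ} (f : Fin n → H) (g : Fin m → H) :
    TensorPower.mulEquiv (R := 𝕜) (tprod 𝕜 f ⊗ₜ tprod 𝕜 g) = tprod 𝕜 (Fin.append f g) :=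
  TensorPower.tprod_mul_tprod 𝕜 f g

end TensorCons

/-! ### Iterated coproducts, reduced and full -/

section Iterated

variable (𝕜 : Type*) {H : Type*} [Field 𝕜] [CommRing H] [HopfAlgebra 𝕜 H]

theorem toPowerOne_apply (x : H) : toPowerOne 𝕜 H x = tprod 𝕜 fun _ => x := by
  simp only [toPowerOne]
  exact PiTensorProduct.subsingletonEquiv_symm_apply' 0 x

theorem toPowerTwo_tmul (x y : H) : toPowerTwo 𝕜 H (x ⊗ₜ y) = tensorCons 𝕜 1 x (toPowerOne 𝕜 H y) := by
  simp only [toPowerTwo, LinearEquiv.trans_apply, TensorProduct.congr_tmul, toPowerOne_apply,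
    tensorCons_tprod]
  refine (mulEquiv_tprod_tmul_tprod 𝕜 _ _).trans (congrArg (PiTensorProduct.tprod 𝕜) ?_)
  ext j
  fin_cases j <;> rfl

theorem applyLast_tprod (g : H →ₗ[𝕜] H ⊗[𝕜] H) {n : ℕ} (f : Fin (n + 1) → H) :
    applyLast 𝕜 g n (tprod 𝕜 f) = TensorPower.mulEquiv (R := 𝕜)
      (tprod 𝕜 (fun j : Fin n => f j.castSucc) ⊗ₜ toPowerTwo 𝕜 H (g (f (Fin.last n)))) := by
  have hf : tprod 𝕜 f = TensorPower.mulEquiv (R := 𝕜)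
      (tprod 𝕜 (fun j : Fin n => f j.castSucc) ⊗ₜ toPowerOne 𝕜 H (f (Fin.last n))) := by
    rw [toPowerOne_apply, mulEquiv_tprod_tmul_tprod]
    congr 1
    ext j
    refine Fin.lastCases ?_ (fun j => ?_) j
    · exact (Fin.append_right (fun j : Fin n => f j.castSucc) (fun _ : Fin 1 => f (Fin.last n)) 0).symm
    · exact (Fin.append_left (fun j : Fin n => f j.castSucc) (fun _ : Fin 1 => f (Fin.last n)) j).symm
  rw [hf]
  simp [applyLast]

theorem tensorCons_mulEquiv {n : ℕ} (x : H) (f : Fin n → H) (z : H ⊗[𝕜] H) :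
    tensorCons 𝕜 (n + 2) x (TensorPower.mulEquiv (R := 𝕜) (tprod 𝕜 f ⊗ₜ toPowerTwo 𝕜 H z)) =
      TensorPower.mulEquiv (R := 𝕜) (n := n + 1) (m := 2)
        (tprod 𝕜 (Fin.cons x f : Fin (n + 1) → H) ⊗ₜ toPowerTwo 𝕜 H z) := by
  induction z using TensorProduct.induction_on with
  | zero => simp
  | tmul y z =>
    simp only [toPowerTwo_tmul, toPowerOne_apply, tensorCons_tprod, mulEquiv_tprod_tmul_tprod,
      Fin.append_cons]
    rfl
  | add y z hy hz => simp only [map_add, TensorProduct.tmul_add, hy, hz]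

/-- Operations at opposite ends of a tensor commute. This converts iteration on the last factor into
recursion from the first one, without coassociativity. -/
theorem applyLast_tensorCons (g : H →ₗ[𝕜] H ⊗[𝕜] H) {n : ℕ} (x : H) (t : ⨂[𝕜]^(n + 1) H) :
    applyLast 𝕜 g (n + 1) (tensorCons 𝕜 (n + 1) x t) =
      tensorCons 𝕜 (n + 2) x (applyLast 𝕜 g n t) := by
  induction t using PiTensorProduct.induction_on with
  | smul_tprod r f =>
    simp only [map_smul, tensorCons_tprod, applyLast_tprod, tensorCons_mulEquiv]
    congr 4
    ext j
    refine Fin.cases ?_ (fun j => ?_) j <;> simp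
  | add s t hs ht => simp only [map_add, hs, ht]

/-- The iterated reduced coproduct `Δ̄^{[k+1]}` is `(id ⊗ Δ̄^{[k]}) ∘ Δ̄`. -/
theorem iteratedReducedComul_succ (n : ℕ) (x : H) :
    iteratedReducedComul 𝕜 H (n + 2) x = consAlgHom 𝕜 H (n + 1)
      ((iteratedReducedComul 𝕜 H (n + 1)).lTensor H (reducedComul 𝕜 H x)) := by
  induction n generalizing x with
  | zero =>
    have h1 : iteratedReducedComul 𝕜 H 1 x = tprod 𝕜 fun _ => x := toPowerOne_apply 𝕜 x
    change applyLast 𝕜 (reducedComul 𝕜 H) 0 (iteratedReducedComul 𝕜 H 1 x) = _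
    rw [h1, applyLast_tprod]
    generalize reducedComul 𝕜 H x = z
    induction z using TensorProduct.induction_on with
    | zero => simp
    | tmul y z =>
      simp only [toPowerTwo_tmul, toPowerOne_apply, tensorCons_tprod, mulEquiv_tprod_tmul_tprod,
        LinearMap.lTensor_tmul, consAlgHom_tmul]
      change _ = tensorCons 𝕜 1 y (toPowerOne 𝕜 H z)
      rw [toPowerOne_apply, tensorCons_tprod]
      congr 1
      ext j
      fin_cases j <;> rfl
    | add y z hy hz => simp only [map_add, TensorProduct.tmul_add, hy, hz]
  | succ n ih =>
    change applyLast 𝕜 (reducedComul 𝕜 H) (n + 1) (iteratedReducedComul 𝕜 H (n + 2) x) = _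
    rw [ih]
    generalize reducedComul 𝕜 H x = z
    induction z using TensorProduct.induction_on with
    | zero => simp
    | tmul y z =>
      simp only [LinearMap.lTensor_tmul, consAlgHom_tmul, applyLast_tensorCons]
      rfl
    | add y z hy hz => simp only [map_add, hy, hz]

variable (H)

/-- The `k`-fold iterated (unreduced) coproduct. -/
def iteratedComul : (k : ℕ) → H →ₐ[𝕜] ⨂[𝕜]^k H
  | 0 => (Algebra.ofId 𝕜 _).comp (Bialgebra.counitAlgHom 𝕜 H)
  | k + 1 => (consAlgHom 𝕜 H k).comp
      ((Algebra.TensorProduct.map (AlgHom.id 𝕜 H) (iteratedComul k)).comp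
        (Bialgebra.comulAlgHom 𝕜 H))

/-- The projection of `H` on its augmentation ideal. -/
def augProj : H →ₗ[𝕜] H :=
  LinearMap.id - Algebra.linearMap 𝕜 H ∘ₗ Coalgebra.counit

variable {H}

theorem augProj_apply (x : H) :
    augProj 𝕜 H x = x - algebraMap 𝕜 H (Coalgebra.counit (R := 𝕜) x) := rfl

theorem augProj_one : augProj 𝕜 H 1 = 0 := by simp [augProj_apply]

theorem augProj_of_counit_eq_zero {x : H} (hx : Coalgebra.counit (R := 𝕜) x = 0) :
    augProj 𝕜 H x = x := by simp [augProj_apply, hx]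

theorem counit_augProj (x : H) : Coalgebra.counit (R := 𝕜) (augProj 𝕜 H x) = 0 := by
  simp [augProj_apply]

theorem iteratedComul_succ_apply (k : ℕ) (x : H) :
    iteratedComul 𝕜 H (k + 1) x = consAlgHom 𝕜 H k
      ((iteratedComul 𝕜 H k).toLinearMap.lTensor H (Coalgebra.comul x)) := rfl

theorem reducedComul_apply (x : H) :
    reducedComul 𝕜 H x = Coalgebra.comul x - x ⊗ₜ 1 - 1 ⊗ₜ x := rfl

/-- Expand (id - ηε) ⊗ (id - ηε), with η the unit map; the counit axioms evaluate the three
correction terms. -/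
theorem map_augProj_comul (x : H) :
    TensorProduct.map (augProj 𝕜 H) (augProj 𝕜 H) (Coalgebra.comul x) =
      reducedComul 𝕜 H x + Coalgebra.counit (R := 𝕜) x • (1 ⊗ₜ[𝕜] 1) := by
  have h1 : ∀ z : H ⊗[𝕜] H, TensorProduct.map (augProj 𝕜 H) (augProj 𝕜 H) z =
      z - TensorProduct.map LinearMap.id (Algebra.linearMap 𝕜 H)
          ((Coalgebra.counit (R := 𝕜) (A := H)).lTensor H z)
        - TensorProduct.map (Algebra.linearMap 𝕜 H) LinearMap.id
          ((Coalgebra.counit (R := 𝕜) (A := H)).rTensor H z)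
        + TensorProduct.map (Algebra.linearMap 𝕜 H)
            (Algebra.linearMap 𝕜 H ∘ₗ Coalgebra.counit (R := 𝕜) (A := H))
          ((Coalgebra.counit (R := 𝕜) (A := H)).rTensor H z) := by
    intro z
    induction z using TensorProduct.induction_on with
    | zero => simp
    | tmul y z =>
      simp [augProj_apply, TensorProduct.sub_tmul, TensorProduct.tmul_sub]
      abel
    | add y z hy hz =>
      simp only [map_add, hy, hz]
      abel
  rw [h1, Coalgebra.lTensor_counit_comul, Coalgebra.rTensor_counit_comul]
  simp [reducedComul_apply, Algebra.algebraMap_eq_smul_one]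

theorem map_augProj_one (k : ℕ) :
    PiTensorProduct.map (fun _ : Fin (k + 1) => augProj 𝕜 H) (1 : ⨂[𝕜]^(k + 1) H) = 0 := by
  change PiTensorProduct.map (fun _ : Fin (k + 1) => augProj 𝕜 H) (PiTensorProduct.tprod 𝕜 1) = 0
  rw [PiTensorProduct.map_tprod]
  exact MultilinearMap.map_coord_zero _ 0 (augProj_one 𝕜)

/-- On the augmentation ideal, the iterated reduced coproduct is the projection of the iterated
coproduct on the tensor power of the augmentation ideal. -/
theorem iteratedReducedComul_augProj (k : ℕ) (x : H) :
    iteratedReducedComul 𝕜 H (k + 1) (augProj 𝕜 H x) =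
      PiTensorProduct.map (fun _ => augProj 𝕜 H) (iteratedComul 𝕜 H (k + 1) x) := by
  induction k generalizing x with
  | zero =>
    -- Since Δ^(0) is the counit, Δ^(1) is the identity by the counit axiom.
    have h0 : ∀ z : H ⊗[𝕜] H, consAlgHom 𝕜 H 0 ((iteratedComul 𝕜 H 0).toLinearMap.lTensor H z) =
        toPowerOne 𝕜 H (TensorProduct.rid 𝕜 H
          ((Coalgebra.counit (R := 𝕜) (A := H)).lTensor H z)) := by
      intro z
      induction z using TensorProduct.induction_on with
      | zero => simp
      | tmul y z =>
        have : iteratedComul 𝕜 H 0 z =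
            Coalgebra.counit (R := 𝕜) z • PiTensorProduct.tprod 𝕜 (1 : Fin 0 → H) :=
          Algebra.algebraMap_eq_smul_one (A := ⨂[𝕜]^0 H) (Coalgebra.counit (R := 𝕜) z)
        simp only [LinearMap.lTensor_tmul, AlgHom.toLinearMap_apply, this, consAlgHom_tmul,
          map_smul, tensorCons_tprod, TensorProduct.rid_tmul, toPowerOne_apply]
        congr 2
        ext j
        fin_cases j
        rfl
      | add y z hy hz => simp only [map_add, hy, hz]
    rw [iteratedComul_succ_apply, h0, Coalgebra.lTensor_counit_comul, TensorProduct.rid_tmul,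
      one_smul, toPowerOne_apply, PiTensorProduct.map_tprod]
    exact toPowerOne_apply 𝕜 _
  | succ k ih =>
    have hmain : ∀ z : H ⊗[𝕜] H,
        consAlgHom 𝕜 H (k + 1) ((iteratedReducedComul 𝕜 H (k + 1)).lTensor H
          (TensorProduct.map (augProj 𝕜 H) (augProj 𝕜 H) z)) =
        PiTensorProduct.map (fun _ => augProj 𝕜 H) (consAlgHom 𝕜 H (k + 1)
          ((iteratedComul 𝕜 H (k + 1)).toLinearMap.lTensor H z)) := by
      intro z
      induction z using TensorProduct.induction_on with
      | zero => simp
      | tmul y z => simp [map_tensorCons, ih]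
      | add y z hy hz => simp only [map_add, hy, hz]
    have hred : reducedComul 𝕜 H (augProj 𝕜 H x) =
        TensorProduct.map (augProj 𝕜 H) (augProj 𝕜 H)
          (Coalgebra.comul (R := 𝕜) (augProj 𝕜 H x)) := by
      rw [map_augProj_comul, counit_augProj, zero_smul, add_zero]
    -- Replacing the projection of x by x changes Δ^(k+2) by a multiple of 1, which the projection
    -- kills.
    rw [iteratedReducedComul_succ, hred, hmain, ← iteratedComul_succ_apply, augProj_apply,
      map_sub, map_sub, AlgHom.commutes, Algebra.algebraMap_eq_smul_one, map_smul,
      map_augProj_one, smul_zero, sub_zero]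

end Iterated

/-! ### Sums over strictly order preserving maps -/

section LevelSum

variable (𝕜 : Type*) {H : Type*} [Field 𝕜] [CommRing H] [Algebra 𝕜 H]

open scoped Classical in
/-- The tensor `(∏_{f x = 1} d x) ⊗ ⋯ ⊗ (∏_{f x = k} d x)`. -/
def levelTensor {P : Type*} [Fintype P] {k : ℕ} (d : P → H) (f : P → Fin k) : ⨂[𝕜]^k H :=
  tprod 𝕜 fun j : Fin k => ∏ x : P with f x = j, d x

open scoped Classical in
/-- The sum of the tensors `levelTensor d f` over all strictly order preserving maps
`f : P → {1, ..., k}`. -/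
def levelSum (k : ℕ) {P : Type*} [PartialOrder P] [Fintype P] (d : P → H) : ⨂[𝕜]^k H :=
  ∑ f : P → Fin k with StrictMono f, levelTensor 𝕜 d f

/-- Written as a product over vertices in the algebra H^{⊗k}, the tensor is visibly multiplicative
on disjoint unions. -/
theorem levelTensor_eq_prod {P : Type*} [Fintype P] {k : ℕ} (d : P → H) (f : P → Fin k) :
    levelTensor 𝕜 d f =
      ∏ x : P, PiTensorProduct.tprod 𝕜 (Pi.mulSingle (M := fun _ : Fin k => H) (f x) (d x)) := by
  rw [← tprod_prod, levelTensor]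
  congr 1
  ext j
  simp [Finset.prod_apply, Pi.mulSingle_apply, Finset.prod_filter, eq_comm]

/-- A strict map on a disjoint union is an arbitrary family of strict maps on the pieces.
Surjectivity would break this independence. -/
theorem levelSum_sigma {ι : Type*} [Fintype ι] {P : ι → Type*} [∀ a, PartialOrder (P a)]
    [∀ a, Fintype (P a)] (k : ℕ) (d : (Σ a, P a) → H) :
    levelSum 𝕜 k d = ∏ a, levelSum 𝕜 k fun x : P a => d ⟨a, x⟩ := by
  classical
  simp only [levelSum]
  rw [Finset.prod_univ_sum]
  refine Finset.sum_equiv (Equiv.piCurry fun (a : ι) (_ : P a) => Fin k) (fun f => ?_)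
    (fun f _ => ?_)
  · simp only [Finset.mem_filter, Finset.mem_univ, true_and, Fintype.mem_piFinset]
    constructor
    · intro hf a x y hxy
      exact hf (Sigma.mk_lt_mk_iff.2 hxy)
    · rintro hf ⟨a, x⟩ ⟨a', y⟩ hxy
      cases hxy with
      | fiber _ _ _ hxy => exact hf a hxy
  · simp only [levelTensor_eq_prod, Fintype.prod_sigma]
    rfl

theorem levelTensor_succ {P : Type*} [Fintype P] {k : ℕ} (d : P → H) (f : P → Fin k) :
    levelTensor 𝕜 d (fun x => (f x).succ) = tensorCons 𝕜 k 1 (levelTensor 𝕜 d f) := by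
  simp only [levelTensor, tensorCons_tprod]
  congr 1
  ext j
  refine Fin.cases ?_ (fun j => ?_) j <;> simp [Fin.succ_ne_zero]

theorem levelTensor_withBot {P : Type*} [Fintype P] {k : ℕ} (d : WithBot P → H)
    (f : WithBot P → Fin (k + 1)) (g : P → Fin k) (h0 : f ⊥ = 0) (hf : ∀ x : P, f x = (g x).succ) :
    levelTensor 𝕜 d f = tensorCons 𝕜 k (d ⊥) (levelTensor 𝕜 (fun x : P => d x) g) := by
  have hprod : ∀ F : WithBot P → H, ∏ x, F x = F ⊥ * ∏ x : P, F x := fun F => Fintype.prod_option F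
  simp only [levelTensor, tensorCons_tprod, Finset.prod_filter, hprod, h0, hf]
  congr 1
  ext j
  refine Fin.cases ?_ (fun j => ?_) j <;> simp [Fin.succ_ne_zero, (Fin.succ_ne_zero _).symm]

theorem levelSum_withBot {P : Type*} [PartialOrder P] [Fintype P] (k : ℕ) (d : WithBot P → H) :
    levelSum 𝕜 (k + 1) d =
      tensorCons 𝕜 k (d ⊥) (levelSum 𝕜 k fun x : P => d x) + tensorCons 𝕜 k 1 (levelSum 𝕜 k d) := by
  classical
  simp only [levelSum]
  -- Split by whether the minimum lies on the lowest level. In either case, strictness keeps all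
  -- other elements off that level, and they shift down by one.
  rw [← Finset.sum_filter_add_sum_filter_not _ (fun f : WithBot P → Fin (k + 1) => f ⊥ = 0)]
  congr 1
  · rw [map_sum]
    symm
    refine Finset.sum_bij
      (fun g _ => fun x => WithBot.recBotCoe (C := fun _ => Fin (k + 1)) 0 (fun y => (g y).succ) x)
      ?_ ?_ ?_ ?_
    · intro g hg
      simp only [Finset.mem_filter, Finset.mem_univ, true_and] at hg ⊢
      refine ⟨WithBot.strictMono_iff.2 ⟨fun x y hxy => ?_, fun x => ?_⟩, rfl⟩
      · exact Fin.succ_lt_succ_iff.2 (hg hxy)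
      · exact Fin.succ_pos _
    · intro g _ g' _ hgg'
      funext x
      have := congrFun hgg' (x : WithBot P)
      simpa using this
    · intro f hf
      simp only [Finset.mem_filter, Finset.mem_univ, true_and] at hf
      obtain ⟨hf, h0⟩ := hf
      have hne : ∀ x : P, f x ≠ 0 := fun x hx =>
        (hf (WithBot.bot_lt_coe x)).ne (h0.trans hx.symm)
      refine ⟨fun x => (f x).pred (hne x), ?_, ?_⟩
      · simp only [Finset.mem_filter, Finset.mem_univ, true_and]
        intro x y hxy
        exact Fin.pred_lt_pred_iff.2 (hf (WithBot.coe_lt_coe.2 hxy))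
      · ext x
        induction x using WithBot.recBotCoe <;> simp [h0]
    · intro g _
      exact (levelTensor_withBot 𝕜 d _ g rfl fun _ => rfl).symm
  · rw [map_sum]
    symm
    refine Finset.sum_bij (fun g _ => fun x => (g x).succ) ?_ ?_ ?_ ?_
    · intro g hg
      simp only [Finset.mem_filter, Finset.mem_univ, true_and] at hg ⊢
      exact ⟨fun x y hxy => Fin.succ_lt_succ_iff.2 (hg hxy), Fin.succ_ne_zero _⟩
    · intro g _ g' _ hgg'
      funext x
      have := congrFun hgg' x
      simpa using this
    · intro f hf
      simp only [Finset.mem_filter, Finset.mem_univ, true_and] at hf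
      obtain ⟨hf, h0⟩ := hf
      have hne : ∀ x, f x ≠ 0 := fun x hx =>
        h0 (le_antisymm ((hf.monotone bot_le).trans hx.le) (Fin.zero_le _))
      refine ⟨fun x => (f x).pred (hne x), ?_, ?_⟩
      · simp only [Finset.mem_filter, Finset.mem_univ, true_and]
        intro x y hxy
        exact Fin.pred_lt_pred_iff.2 (hf hxy)
      · ext x
        simp
    · intro g _
      exact (levelTensor_succ 𝕜 d g).symm

theorem levelSum_unique {P : Type*} [PartialOrder P] [Fintype P] [Unique P] (k : ℕ) (d : P → H) :
    levelSum 𝕜 (k + 1) d =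
      tensorCons 𝕜 k (d default) 1 + tensorCons 𝕜 k 1 (levelSum 𝕜 k d) := by
  classical
  have hsum : ∀ m, levelSum 𝕜 m d = ∑ j : Fin m, levelTensor 𝕜 d fun _ => j := by
    intro m
    rw [levelSum, Finset.filter_true_of_mem (fun f _ => Subsingleton.strictMono f)]
    refine (Finset.sum_equiv (Equiv.funUnique P (Fin m)).symm ?_ fun _ _ => rfl).symm
    simp
  rw [hsum, hsum, Fin.sum_univ_succ, map_sum]
  congr 1
  · change levelTensor 𝕜 d _ = tensorCons 𝕜 k _ (PiTensorProduct.tprod 𝕜 1)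
    simp only [levelTensor, tensorCons_tprod]
    congr 1
    ext j
    refine Fin.cases ?_ (fun j => ?_) j <;> simp [(Fin.succ_ne_zero _).symm]
  · exact Finset.sum_congr rfl fun j _ => levelTensor_succ 𝕜 d fun _ => j

end LevelSum

/-! ### Projection selects the surjective maps -/

section Projection

variable (𝕜 : Type*) {H : Type*} [Field 𝕜] [CommRing H] [HopfAlgebra 𝕜 H]

theorem counit_prod_eq_zero {P : Type*} {d : P → H}
    (hd : ∀ x, Coalgebra.counit (R := 𝕜) (d x) = 0) {s : Finset P} (hs : s.Nonempty) :
    Coalgebra.counit (R := 𝕜) (∏ x ∈ s, d x) = 0 := by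
  obtain ⟨x, hx⟩ := hs
  change Bialgebra.counitAlgHom 𝕜 H _ = 0
  rw [map_prod]
  exact Finset.prod_eq_zero hx (hd x)

open scoped Classical in
theorem map_augProj_levelTensor {P : Type*} [Fintype P] {k : ℕ} {d : P → H}
    (hd : ∀ x, Coalgebra.counit (R := 𝕜) (d x) = 0) (f : P → Fin k) :
    PiTensorProduct.map (fun _ => augProj 𝕜 H) (levelTensor 𝕜 d f) =
      if Function.Surjective f then levelTensor 𝕜 d f else 0 := by
  rw [levelTensor, PiTensorProduct.map_tprod]
  split_ifs with hf
  · congr 1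
    ext j
    obtain ⟨x, hx⟩ := hf j
    exact augProj_of_counit_eq_zero 𝕜 (counit_prod_eq_zero 𝕜 hd ⟨x, by simp [hx]⟩)
  · obtain ⟨j, hj⟩ := not_forall.1 hf
    refine MultilinearMap.map_coord_zero _ j ?_
    rw [Finset.filter_false_of_mem fun x _ hx => hj ⟨x, hx⟩, Finset.prod_empty, augProj_one]

end Projection

/-! ### The reduced coproduct of a basis element -/

section StructureCoeff

variable {𝕜 V H X : Type*} [Field 𝕜] [AddCommGroup V] [Module 𝕜 V]
  [CommRing H] [HopfAlgebra 𝕜 H] [DecidableEq X] {incl : V →ₗ[𝕜] H}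
  (h : IsRightHandedPolynomial incl) (b : Module.Basis X 𝕜 V)

theorem monomialBasis_singleton (i : X) : monomialBasis h b {i} = incl (b i) := by
  simp [monomialBasis_apply]

theorem monomialBasis_eq_prod (I : Multiset X) :
    monomialBasis h b I = ∏ a : I, incl (b a.1) := by
  rw [monomialBasis_apply, ← Multiset.map_univ]
  rfl

theorem monomialBasis_repr_incl (v : V) (i : X) :
    (monomialBasis h b).repr (incl v) {i} = b.repr v i := by
  have : (monomialBasis h b).coord {i} ∘ₗ incl = b.coord i := by
    refine b.ext fun j => ?_
    simp [← monomialBasis_singleton h b, Finsupp.single_apply]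
  exact LinearMap.congr_fun this v

theorem counit_eq_repr_zero (c : H) :
    Coalgebra.counit (R := 𝕜) c = (monomialBasis h b).repr c 0 := by
  have : Coalgebra.counit = (monomialBasis h b).coord 0 := by
    refine (monomialBasis h b).ext fun I => ?_
    rcases eq_or_ne I 0 with rfl | hI
    · rw [Module.Basis.coord_apply, Module.Basis.repr_self, Finsupp.single_eq_same,
        monomialBasis_apply, Multiset.map_zero, Multiset.prod_zero, Bialgebra.counit_one]
    · have hcounit : Coalgebra.counit (R := 𝕜) (monomialBasis h b I) = 0 := by
        obtain ⟨a, ha⟩ := Multiset.exists_mem_of_ne_zero hI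
        rw [monomialBasis_eq_prod]
        exact counit_prod_eq_zero 𝕜 (fun a : I => h.counit_incl (b a.1))
          ⟨⟨a, ⟨0, Multiset.count_pos.2 ha⟩⟩, Finset.mem_univ _⟩
      rw [hcounit, Module.Basis.coord_apply, Module.Basis.repr_self,
        Finsupp.single_eq_of_ne hI.symm]
  exact LinearMap.congr_fun this c

/-- Applying id ⊗ ε to the reduced coproduct of b_i gives b_i - b_i - ε(b_i)1 = 0, and ε reads off
the coefficient of the empty monomial. -/
theorem structureCoeff_zero (i i₀ : X) : structureCoeff h b i i₀ 0 = 0 := by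
  have h1 : ∀ z : H ⊗[𝕜] H,
      ((monomialBasis h b).tensorProduct (monomialBasis h b)).repr z ({i₀}, 0) =
        (monomialBasis h b).repr (TensorProduct.rid 𝕜 H
          ((Coalgebra.counit (R := 𝕜) (A := H)).lTensor H z)) {i₀} := by
    intro z
    induction z using TensorProduct.induction_on with
    | zero => simp
    | tmul x y => simp [counit_eq_repr_zero h b, mul_comm]
    | add x y hx hy => simp only [map_add, Finsupp.add_apply, hx, hy]
  rw [structureCoeff, h1, reducedComul_apply]
  simp only [map_sub (LinearMap.lTensor _ _), Coalgebra.lTensor_counit_comul]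
  simp [h.counit_incl]

/-- The elements `(i₀, I)`, `I ≠ ∅`, such that `b_{i₀} ⊗ b_I` occurs in the reduced coproduct of
`b_i`. -/
def coeffSupport (i : X) : Finset {p : X × Multiset X // p.2 ≠ 0} :=
  (Finsupp.comapDomain (fun p : {p : X × Multiset X // p.2 ≠ 0} => (({p.1.1} : Multiset X), p.1.2))
    (((monomialBasis h b).tensorProduct (monomialBasis h b)).repr (reducedComul 𝕜 H (incl (b i))))
    (by
      rintro ⟨⟨i, I⟩, hI⟩ _ ⟨⟨j, J⟩, hJ⟩ _ hIJ
      simpa using hIJ)).support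

theorem mem_coeffSupport {i : X} {p : {p : X × Multiset X // p.2 ≠ 0}} :
    p ∈ coeffSupport h b i ↔ structureCoeff h b i p.1.1 p.1.2 ≠ 0 := by
  rw [coeffSupport, Finsupp.mem_support_iff]
  rfl

/-- Right-handedness lifts the reduced coproduct to V ⊗ H, where it is expanded in the basis b_{i₀}
⊗ b_I; the terms with I = ∅ vanish by `structureCoeff_zero`. -/
theorem reducedComul_basis (i : X) :
    reducedComul 𝕜 H (incl (b i)) = ∑ p ∈ coeffSupport h b i,
      structureCoeff h b i p.1.1 p.1.2 • (incl (b p.1.1) ⊗ₜ[𝕜] monomialBasis h b p.1.2) := by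
  classical
  obtain ⟨y, hy⟩ := h.rightHanded (b i)
  have hrepr : ∀ y : V ⊗[𝕜] H, ∀ p : X × Multiset X,
      ((monomialBasis h b).tensorProduct (monomialBasis h b)).repr (incl.rTensor H y) ({p.1}, p.2) =
        (b.tensorProduct (monomialBasis h b)).repr y p := by
    intro y p
    induction y using TensorProduct.induction_on with
    | zero => simp
    | tmul v c => simp [monomialBasis_repr_incl h b, Module.Basis.tensorProduct_repr_tmul_apply b]
    | add x y hx hy => simp only [map_add, Finsupp.add_apply, hx, hy]
  have hcoeff : ∀ p : X × Multiset X,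
      (b.tensorProduct (monomialBasis h b)).repr y p = structureCoeff h b i p.1 p.2 := by
    intro p
    rw [structureCoeff, ← hy, hrepr]
  conv_lhs => rw [← hy, ← (b.tensorProduct (monomialBasis h b)).linearCombination_repr y]
  rw [Finsupp.linearCombination_apply, Finsupp.sum, map_sum]
  symm
  refine Finset.sum_bij (fun p _ => p.1) ?_ ?_ ?_ ?_
  · intro p hp
    rw [mem_coeffSupport] at hp
    rwa [Finsupp.mem_support_iff, hcoeff]
  · intro p _ q _ hpq
    exact Subtype.ext hpq
  · rintro ⟨i₀, I⟩ hp
    rw [Finsupp.mem_support_iff, hcoeff] at hp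
    have hI : I ≠ 0 := by
      rintro rfl
      exact hp (structureCoeff_zero h b i i₀)
    exact ⟨⟨(i₀, I), hI⟩, (mem_coeffSupport h b).2 hp, rfl⟩
  · intro p _
    rw [hcoeff, map_smul, Module.Basis.tensorProduct_apply', LinearMap.rTensor_tmul]

end StructureCoeff

/-! ### Expansion of the iterated coproduct over trees -/

universe u

namespace DecTree

variable {𝕜 V H : Type*} {X : Type u} [Field 𝕜] [AddCommGroup V] [Module 𝕜 V]
  [CommRing H] [HopfAlgebra 𝕜 H] [DecidableEq X] {incl : V →ₗ[𝕜] H}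

instance instUniqueVertexLeaf (i : X) : Unique (leaf i).Vertex := inferInstanceAs (Unique PUnit)

instance instNonemptyVertex {i : X} (T : DecTree X i) : Nonempty T.Vertex := by
  cases T with
  | leaf i => infer_instance
  | node i i₀ I hI branch => exact ⟨(⊥ : WithBot (Σ a : I, (branch a).Vertex))⟩

variable (incl) (b : Module.Basis X 𝕜 V)

/-- The sum of the tensors `C(f)` over all strictly order preserving maps from the vertices of `T`
to `{1, ..., k}`. -/
def levelSum (k : ℕ) {i : X} (T : DecTree X i) : ⨂[𝕜]^k H :=
  RightHanded.levelSum 𝕜 k fun x => incl (b (T.d₂ x))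

theorem levelSum_leaf (k : ℕ) (i : X) :
    (leaf i).levelSum incl b (k + 1) =
      tensorCons 𝕜 k (incl (b i)) 1 + tensorCons 𝕜 k 1 ((leaf i).levelSum incl b k) :=
  levelSum_unique 𝕜 k _

theorem levelSum_node (k : ℕ) (i i₀ : X) (I : Multiset X) (hI : I ≠ 0)
    (branch : (a : I) → DecTree X a.1) :
    (node i i₀ I hI branch).levelSum incl b (k + 1) =
      tensorCons 𝕜 k (incl (b i₀)) (∏ a : I, (branch a).levelSum incl b k) +
        tensorCons 𝕜 k 1 ((node i i₀ I hI branch).levelSum incl b k) := by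
  -- By definition the vertices form a disjoint union of branches with a minimum added.
  have h1 := levelSum_withBot (P := Σ a : I, (branch a).Vertex) 𝕜 k
    (fun x => incl (b ((node i i₀ I hI branch).d₂ x)))
  have h2 := levelSum_sigma (P := fun a : I => (branch a).Vertex) 𝕜 k
    (fun x => incl (b ((branch x.1).d₂ x.2)))
  have h3 := h2 ▸ h1
  exact h3

variable {incl} (h : IsRightHandedPolynomial incl)

/-- The map `((i₀, I), (T_j)) ↦ B⁺_{(i;i₀)}(T_1 ⋯ T_s)`. -/
def nodeEmbedding (i : X) :
    (Σ p : {p : X × Multiset X // p.2 ≠ 0}, (a : p.1.2) → DecTree X a.1) ↪ DecTree X i where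
  toFun q := node i q.1.1.1 q.1.1.2 q.1.2 q.2
  inj' := by
    rintro ⟨⟨⟨i₀, I⟩, hI⟩, br⟩ ⟨⟨⟨j₀, J⟩, hJ⟩, br'⟩ hq
    simp only [node.injEq] at hq
    obtain ⟨rfl, rfl, hbr⟩ := hq
    cases hbr
    rfl

theorem nodeEmbedding_mk (i : X) (p : {p : X × Multiset X // p.2 ≠ 0})
    (branch : (a : p.1.2) → DecTree X a.1) :
    nodeEmbedding i ⟨p, branch⟩ = node i p.1.1 p.1.2 p.2 branch := rfl

open scoped Classical in
/-- A finite set of trees containing all trees with at most `k` levels and nonzero coefficient. -/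
def boundedTrees : ℕ → (i : X) → Finset (DecTree X i)
  | 0, _ => ∅
  | k + 1, i => insert (leaf i) (((coeffSupport h b i).sigma fun p =>
      Fintype.piFinset fun a : p.1.2 => boundedTrees k a.1).map (nodeEmbedding i))

theorem mem_boundedTrees (k : ℕ) {i : X} (T : DecTree X i) (hT : T.coeff h b ≠ 0)
    (f : T.Vertex → Fin k) (hf : StrictMono f) : T ∈ boundedTrees b h k i := by
  classical
  induction k generalizing i with
  | zero => exact (f (Classical.arbitrary _)).elim0
  | succ k ih =>
    rw [boundedTrees, Finset.mem_insert]
    cases T with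
    | leaf i => exact Or.inl rfl
    | node i i₀ I hI branch =>
      right
      rw [coeff] at hT
      refine Finset.mem_map.2 ⟨⟨⟨(i₀, I), hI⟩, branch⟩, ?_, rfl⟩
      rw [Finset.mem_sigma, mem_coeffSupport, Fintype.mem_piFinset]
      refine ⟨left_ne_zero_of_mul hT, fun a => ?_⟩
      have ha : (branch a).coeff h b ≠ 0 :=
        Finset.prod_ne_zero_iff.1 (right_ne_zero_of_mul hT) a (Finset.mem_univ a)
      -- The branches lie strictly above the root, so they avoid level 0 and can be shifted down to
      -- k levels.
      have hf' : StrictMono (show WithBot (Σ a : I, (branch a).Vertex) → Fin (k + 1) from f) := hf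
      let g : (branch a).Vertex → Fin (k + 1) := fun x =>
        f (((⟨a, x⟩ : Σ a : I, (branch a).Vertex)) : WithBot (Σ a : I, (branch a).Vertex))
      have hne : ∀ x, g x ≠ 0 := fun x =>
        (lt_of_le_of_lt (Fin.zero_le _) (hf' (WithBot.bot_lt_coe _))).ne'
      refine ih (branch a) ha (fun x => (g x).pred (hne x)) fun x y hxy => ?_
      exact Fin.pred_lt_pred_iff.2 (hf' (WithBot.coe_lt_coe.2 (Sigma.mk_lt_mk_iff.2 hxy)))

/-- If λ(T) ≠ 0, a tree outside the finite set admits no strict map, so its sum is empty. -/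
theorem coeff_smul_levelSum_eq_zero (k : ℕ) {i : X} (T : DecTree X i)
    (hT : T ∉ boundedTrees b h k i) : T.coeff h b • T.levelSum incl b k = 0 := by
  classical
  by_cases hc : T.coeff h b = 0
  · rw [hc, zero_smul]
  · rw [levelSum, RightHanded.levelSum, Finset.sum_eq_zero, smul_zero]
    intro f hf
    exact absurd (mem_boundedTrees b h k T hc f (Finset.mem_filter.1 hf).2) hT

theorem boundedTrees_mono (k : ℕ) (i : X) : boundedTrees b h k i ⊆ boundedTrees b h (k + 1) i := by
  induction k generalizing i with
  | zero => simp [boundedTrees]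
  | succ k ih =>
    classical
    simp only [boundedTrees] at ih ⊢
    refine Finset.insert_subset_insert _ (Finset.map_subset_map.2 ?_)
    exact Finset.sigma_mono subset_rfl fun p => Fintype.piFinset_subset _ _ fun a => ih a.1

theorem iteratedComul_basis (k : ℕ) (i : X) :
    iteratedComul 𝕜 H k (incl (b i)) =
      ∑ T ∈ boundedTrees b h k i, T.coeff h b • T.levelSum incl b k := by
  classical
  induction k generalizing i with
  | zero =>
    have : iteratedComul 𝕜 H 0 (incl (b i)) =
        algebraMap 𝕜 (⨂[𝕜]^0 H) (Coalgebra.counit (R := 𝕜) (incl (b i))) := rfl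
    rw [this, h.counit_incl, map_zero, boundedTrees, Finset.sum_empty]
  | succ k ih =>
    have hcomul : (Coalgebra.comul (incl (b i)) : H ⊗[𝕜] H) =
        reducedComul 𝕜 H (incl (b i)) + incl (b i) ⊗ₜ 1 + 1 ⊗ₜ incl (b i) := by
      rw [reducedComul_apply]
      abel
    -- Distributing the product chooses one tree for each occurrence in I, which is why repeated
    -- indices are kept distinct.
    have hmono : ∀ I : Multiset X, iteratedComul 𝕜 H k (monomialBasis h b I) =
        ∑ br ∈ Fintype.piFinset fun a : I => boundedTrees b h k a.1,
          (∏ a, (br a).coeff h b) • ∏ a, (br a).levelSum incl b k := by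
      intro I
      rw [monomialBasis_eq_prod, map_prod]
      simp only [ih, Finset.prod_univ_sum, Finset.prod_smul]
    -- The maps avoiding the first level sum to 1 ⊗ Δ^(k)(b_i): trees in the larger set but not the
    -- smaller contribute zero. What remains has the root on the first level.
    have hsplit : ∑ T ∈ boundedTrees b h (k + 1) i, T.coeff h b • T.levelSum incl b (k + 1) =
        ∑ T ∈ boundedTrees b h (k + 1) i, T.coeff h b •
          (T.levelSum incl b (k + 1) - tensorCons 𝕜 k 1 (T.levelSum incl b k)) +
        tensorCons 𝕜 k 1 (iteratedComul 𝕜 H k (incl (b i))) := by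
      rw [ih, Finset.sum_subset (boundedTrees_mono b h k i)
        fun T _ hT => coeff_smul_levelSum_eq_zero b h k T hT, map_sum, ← Finset.sum_add_distrib]
      refine Finset.sum_congr rfl fun T _ => ?_
      rw [map_smul, smul_sub, sub_add_cancel]
    rw [hsplit, boundedTrees, Finset.sum_insert (by simp [nodeEmbedding]), Finset.sum_map,
      Finset.sum_sigma, iteratedComul_succ_apply, hcomul, reducedComul_basis h b]
    simp only [map_add, map_sum, map_smul, LinearMap.lTensor_tmul, consAlgHom_tmul,
      AlgHom.toLinearMap_apply, map_one, hmono, nodeEmbedding_mk,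
      levelSum_leaf, levelSum_node, add_sub_cancel_right, coeff, one_smul, Finset.smul_sum, mul_smul]
    abel

/-- The iterated reduced coproduct of `b_i` as a sum over trees and surjective strictly order
preserving maps. -/
theorem iteratedReducedComul_basis (k : ℕ) (i : X) :
    iteratedReducedComul 𝕜 H (k + 1) (incl (b i)) =
      ∑ T ∈ boundedTrees b h (k + 1) i, ∑ f : Linearization T.Vertex (k + 1),
        T.coeff h b • chain incl b T f := by
  classical
  conv_lhs => rw [← augProj_of_counit_eq_zero 𝕜 (h.counit_incl (b i))]
  rw [iteratedReducedComul_augProj, iteratedComul_basis b h, map_sum]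
  refine Finset.sum_congr rfl fun T _ => ?_
  rw [map_smul, ← Finset.smul_sum, levelSum, RightHanded.levelSum, map_sum]
  congr 1
  simp only [map_augProj_levelTensor 𝕜 (fun x => h.counit_incl (b (T.d₂ x)))]
  rw [← Finset.sum_filter, Finset.filter_filter]
  exact Finset.sum_subtype _ (by simp) _

end DecTree

end RightHanded
end

theorem mainTheorem4 {𝕜 V H X : Type*} [Field 𝕜] [CharZero 𝕜] [AddCommGroup V] [Module 𝕜 V]
    [CommRing H] [HopfAlgebra 𝕜 H] [DecidableEq X] (incl : V →ₗ[𝕜] H)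
    (h : RightHanded.IsRightHandedPolynomial incl) (b : Module.Basis X 𝕜 V)
    (k : ℕ) (hk : 2 ≤ k) (i : X) :
    {T : RightHanded.DecTree X i |
        T.coeff h b ≠ 0 ∧ Nonempty (RightHanded.Linearization T.Vertex k)}.Finite ∧
      RightHanded.iteratedReducedComul 𝕜 H k (incl (b i)) =
        ∑ᶠ T : RightHanded.DecTree X i, ∑ f : RightHanded.Linearization T.Vertex k,
          T.coeff h b • RightHanded.chain incl b T f := by
  have hmem : ∀ T : RightHanded.DecTree X i, T.coeff h b ≠ 0 →
      Nonempty (RightHanded.Linearization T.Vertex k) →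
      T ∈ RightHanded.DecTree.boundedTrees b h k i :=
    fun T hT ⟨f⟩ => RightHanded.DecTree.mem_boundedTrees b h k T hT f.1 f.2.1
  refine ⟨(Finset.finite_toSet _).subset fun T hT => hmem T hT.1 hT.2, ?_⟩
  -- A nonzero term requires both λ(T) ≠ 0 and a linearization, so the support lies in the finite
  -- set.
  rw [finsum_eq_sum_of_support_subset (s := RightHanded.DecTree.boundedTrees b h k i)]
  · obtain ⟨m, rfl⟩ : ∃ m, k = m + 1 := ⟨k - 1, by omega⟩
    exact RightHanded.DecTree.iteratedReducedComul_basis b h m i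
  · intro T hT
    obtain ⟨f, -, hf⟩ := Finset.exists_ne_zero_of_sum_ne_zero hT
    exact hmem T (left_ne_zero_of_smul hf) ⟨f⟩
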